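/- Let $n = 4a+4+i \ge 9$, where $a \ge 1$ is an integer and $i \in \{-1, 1\}$. Let $\Omega$ be the set of $n+1$ points consisting of $1, \dots, 2a$, $1', \dots, (2a)'$, $\alpha, \alpha', \beta, \beta'$ and, if $i = 1$, two further points $\gamma, \delta$. Define permutations of $\Omega$ by $$t = (\alpha,\alpha')(\beta,\beta')\prod_{j=1}^{2a}(j,j'),$$ $$s = (1,2,\dots,2a,\alpha,\alpha',\beta,(2a)',(2a-1)',\dots,2',1') \quad\text{if } i=-1,$$ $$s = (1,2,\dots,2a,\alpha,\beta,\gamma,\alpha',(2a)',(2a-1)',\dots,2',1',\delta) \quad\text{if } i=1.$$ Let permutations act on the right (products are read from left to right), and put $r = ts^{-1}$, so that $rs=t$, and $G = \langle r,s\rangle = \langle s,t\rangle$. Then $G$ is the alternating group $A_{n+1}$ on $\Omega$, and $\mathcal{M}(G:r,s)$ is a chiral map of type $\{4,n\}$. Here $\mathcal{M}(G:r,s)$ is the map on an oriented surface whose arcs (directed edges) are the elements of $G$, where $gs$ is the next arc after $g$ in the rotation around its initial vertex, $grs$ is the reverse of the arc $g$, and $gr$ is the next arc after $g$ along a face. Type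 $\{4,n\}$ means that every face has length $4$ and every vertex has degree $n$. A map is chiral if its orientation-preserving automorphisms act transitively on its arcs and it has no orientation-reversing automorphism; for $\mathcal{M}(G:r,s)$ the latter means that no automorphism of $G$ inverts both $r$ and $s$. -/

import Mathlib

/-! ### Oriented maps

A map on an oriented surface is described by its arcs (darts), as usual: `rot` takes an arc to
the next arc, in the positive direction, around its initial vertex, and `rev` takes an arc to the
reverse arc on the same edge.  Vertices, edges and faces are the orbits of `rot`, `rev` and
`rot⁻¹ ∘ rev`; the underlying graph is connected exactly when the arcs form one orbit. -/

structure OrientedMap (D : Type*) where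
  rot : Equiv.Perm D
  rev : Equiv.Perm D
  rev_rev : ∀ d, rev (rev d) = d
  rev_ne : ∀ d, rev d ≠ d
  nonempty : Nonempty D
  connected : ∀ d e : D, ∃ g ∈ Subgroup.closure {rot, rev}, g d = e

namespace OrientedMap

/-- The next arc along the face on the left of an arc. -/
def face {D : Type*} (M : OrientedMap D) : Equiv.Perm D := M.rot⁻¹ * M.rev

/-- The group of orientation-preserving automorphisms. -/
def autPlus {D : Type*} (M : OrientedMap D) : Subgroup (Equiv.Perm D) :=
  Subgroup.centralizer {M.rot, M.rev}

/-- Orientation-preserving automorphisms are transitive on arcs. -/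
def IsOrientablyRegular {D : Type*} (M : OrientedMap D) : Prop :=
  ∀ d e : D, ∃ f ∈ M.autPlus, f d = e

/-- There is an orientation-reversing automorphism. -/
def HasReflection {D : Type*} (M : OrientedMap D) : Prop :=
  ∃ f : Equiv.Perm D, (∀ d, f (M.rot d) = M.rot⁻¹ (f d)) ∧ ∀ d, f (M.rev d) = M.rev (f d)

def IsReflexible {D : Type*} (M : OrientedMap D) : Prop :=
  M.IsOrientablyRegular ∧ M.HasReflection

def IsChiral {D : Type*} (M : OrientedMap D) : Prop :=
  M.IsOrientablyRegular ∧ ¬ M.IsReflexible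

/-- Type `{m, n}`: every face has length `m` and every vertex has degree `n`. -/
def HasType {D : Type*} (M : OrientedMap D) (m n : ℕ) : Prop :=
  (∀ d, Function.minimalPeriod M.face d = m) ∧ ∀ d, Function.minimalPeriod M.rot d = n

/-- The map `M(G : r, s)` of a group `G` generated by `r` and `s` with `r * s` an involution.
The arcs are the elements of `G` (the image of a base arc under `g` is called `g`), on which `G`
acts by left multiplication; `r` and `s` are the one-step rotations about the face and the vertex
at the base arc, and `r * s` reverses the base arc. -/
def ofGroup {G : Type*} [Group G] (r s : G) (hgen : Subgroup.closure {r, s} = ⊤)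
    (hinv : orderOf (r * s) = 2) : OrientedMap G where
  rot := Equiv.mulRight s
  rev := Equiv.mulRight (r * s)
  rev_rev d := by
    have h : (r * s) * (r * s) = 1 := by rw [← pow_two, ← hinv, pow_orderOf_eq_one]
    simp only [Equiv.coe_mulRight, mul_assoc d, h, mul_one]
  rev_ne d h := by
    have h1 : r * s = 1 := by
      apply mul_left_cancel (a := d)
      simpa only [Equiv.coe_mulRight, mul_one] using h
    simp [h1] at hinv
  nonempty := ⟨1⟩
  connected d e := by
    suffices H : ∀ x : G, Equiv.mulRight x ∈
        Subgroup.closure {Equiv.mulRight s, Equiv.mulRight (r * s)} from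
      ⟨_, H (d⁻¹ * e), by simp⟩
    intro x
    have hs : Equiv.mulRight s ∈
        Subgroup.closure {Equiv.mulRight s, Equiv.mulRight (r * s)} :=
      Subgroup.subset_closure (by simp)
    have ht : Equiv.mulRight (r * s) ∈
        Subgroup.closure {Equiv.mulRight s, Equiv.mulRight (r * s)} :=
      Subgroup.subset_closure (by simp)
    have hx : x ∈ Subgroup.closure {r, s} := by rw [hgen]; trivial
    induction hx using Subgroup.closure_induction with
    | mem y hy =>
      rcases hy with rfl | rfl
      · have := mul_mem (inv_mem hs) ht
        convert this using 1
        ext z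
        simp [mul_assoc]
      · exact hs
    | one =>
      convert Subgroup.one_mem _
      ext z
      simp
    | mul y z _ _ hy hz =>
      convert mul_mem hz hy using 1
      ext w
      simp [mul_assoc]
    | inv y _ hy =>
      convert inv_mem hy using 1
      ext z
      simp

end OrientedMap

/-! ### The permutations `s` and `t` -/

/-- The value of `i`, which is `-1` or `1`. -/
inductive PM
  | minus
  | plus
  deriving DecidableEq

def PM.toInt : PM → ℤ
  | .minus => -1
  | .plus => 1

/-- The points with Greek labels; `γ` and `δ` are present only when `i = 1`. -/
inductive Greek : PM → Type
  | α {i : PM} : Greek i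
  | α' {i : PM} : Greek i
  | β {i : PM} : Greek i
  | β' {i : PM} : Greek i
  | γ : Greek .plus
  | δ : Greek .plus
  deriving DecidableEq

instance (i : PM) : Fintype (Greek i) :=
  match i with
  | .minus => ⟨{.α, .α', .β, .β'}, by intro x; cases x <;> simp⟩
  | .plus => ⟨{.α, .α', .β, .β', .γ, .δ}, by intro x; cases x <;> simp⟩

/-- The points `1, …, 2a` (first summand), `1', …, (2a)'` (second) and the Greek ones. -/
abbrev Point (a : ℕ) (i : PM) : Type := (Fin (2 * a) ⊕ Fin (2 * a)) ⊕ Greek i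

namespace Point

/-- `num j` is the point labelled `j + 1`. -/
def num {a : ℕ} {i : PM} (j : Fin (2 * a)) : Point a i := .inl (.inl j)

/-- `num' j` is the point labelled `(j + 1)'`. -/
def num' {a : ℕ} {i : PM} (j : Fin (2 * a)) : Point a i := .inl (.inr j)

/-- The point with the given Greek label. -/
def greek {a : ℕ} {i : PM} (x : Greek i) : Point a i := .inr x

/-- The points in the order in which they are listed in the cycle `s`. -/
def cycleList (a : ℕ) : (i : PM) → List (Point a i)
  | .minus =>
      (List.finRange (2 * a)).map num ++ [greek .α, greek .α', greek .β] ++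
        (List.finRange (2 * a)).reverse.map num'
  | .plus =>
      (List.finRange (2 * a)).map num ++ [greek .α, greek .β, greek .γ, greek .α'] ++
        (List.finRange (2 * a)).reverse.map num' ++ [greek .δ]

end Point

open Point in
/-- The permutation `t = (α, α')(β, β') ∏ⱼ (j, j')`. -/
def tPerm (a : ℕ) (i : PM) : Equiv.Perm (Point a i) :=
  Equiv.swap (greek .α) (greek .α') * Equiv.swap (greek .β) (greek .β') *
    ((List.finRange (2 * a)).map fun j => Equiv.swap (num j) (num' j)).prod

/-- The cycle `s`. -/
def sPerm (a : ℕ) (i : PM) : Equiv.Perm (Point a i) := (Point.cycleList a i).formPerm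

/-- The group of permutations of `X` acting on the right: products are read from left to right. -/
abbrev RightPerm (X : Type*) := (Equiv.Perm X)ᵐᵒᵖ

/-- The group `G = ⟨s, t⟩`. -/
def mapGroup (a : ℕ) (i : PM) : Subgroup (RightPerm (Point a i)) :=
  Subgroup.closure {MulOpposite.op (sPerm a i), MulOpposite.op (tPerm a i)}

/-- `s` as an element of `G`. -/
def sGen (a : ℕ) (i : PM) : mapGroup a i :=
  ⟨MulOpposite.op (sPerm a i), Subgroup.subset_closure (by simp)⟩

/-- `t` as an element of `G`. -/
def tGen (a : ℕ) (i : PM) : mapGroup a i :=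
  ⟨MulOpposite.op (tPerm a i), Subgroup.subset_closure (by simp)⟩

/-- The element `r` of `G` with `t = r * s`. -/
def rGen (a : ℕ) (i : PM) : mapGroup a i := tGen a i * (sGen a i)⁻¹

/-! The proof rests on one explicit `3`-cycle. Put `x = (s⁻¹ * t) ^ 2` in `Equiv.Perm`; this is
the permutation `r ^ 2`. It is a product of two transpositions, one of which moves the fixed point
`β'` of the cycle `s` (`inv_mul_sq_minus`, `inv_mul_sq_plus`). The other three points that it moves
lie within four consecutive places of the cycle, whose length is at least `9`, so `x` and its
conjugate by `s ^ 4` have only `β'` as a common moved point, and their commutator is a `3`-cycle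
(`commutator_swap_mul_swap`).

*The group.* `G` is `2`-transitive, because `s` is transitive on the points other than `β'` and
`t` moves `β'`. A primitive group that contains a `3`-cycle contains the alternating group (Jordan),
and `s` and `t` are even (`closure_eq_alternatingGroup`).

*Chirality.* A reflection would give an endomorphism of `G` that inverts `s` and fixes `t`
(`OrientedMap.exists_hom_of_hasReflection`). Such a map takes any word in `s` and `t` to the same
word in `s⁻¹` and `t`. The word used is the commutator of the above `3`-cycle with its conjugate
by `t` (`chiralityWord`). In `s` and `t` the two `3`-cycles overlap without commuting; in `s⁻¹`
and `t` they are disjoint (`chiralityWord_perm`). This needs no knowledge of the automorphisms of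
the alternating group.

The positions of points on the cycle `s` are read off from `Point.cycleList`. Since `s` is given by
`List.formPerm` of that list, `s ^ k` moves a point `k` places along it (`sPerm_pow_apply`). -/

open scoped commutatorElement

/-! ### Reflections and words in the rotations -/

/-- Orientation-preserving automorphisms of `M(G : r, s)`: left multiplication by any element. -/
theorem OrientedMap.ofGroup_isOrientablyRegular {G : Type*} [Group G] (r s : G)
    (hgen : Subgroup.closure {r, s} = ⊤) (hinv : orderOf (r * s) = 2) :
    (OrientedMap.ofGroup r s hgen hinv).IsOrientablyRegular := by
  intro d e
  refine ⟨Equiv.mulLeft (e * d⁻¹), ?_, by simp⟩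
  rw [OrientedMap.autPlus, Subgroup.mem_centralizer_iff]
  rintro g (rfl | rfl) <;> ext x <;> simp [OrientedMap.ofGroup, mul_assoc]

/-- A reflection of `M(G : r, s)` induces an endomorphism `φ` of `G` which inverts `s` and fixes
the involution `r * s`: the reflection carries right multiplication by `x` to that by `φ x`. -/
theorem OrientedMap.exists_hom_of_hasReflection {G : Type*} [Group G] (r s : G)
    (hgen : Subgroup.closure {r, s} = ⊤) (hinv : orderOf (r * s) = 2)
    (h : (OrientedMap.ofGroup r s hgen hinv).HasReflection) :
    ∃ φ : G →* G, φ s = s⁻¹ ∧ φ (r * s) = r * s := by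
  obtain ⟨f, hs, ht⟩ := h
  have hs' : ∀ d, f (d * s) = f d * s⁻¹ := hs
  have ht' : ∀ d, f (d * (r * s)) = f d * (r * s) := ht
  have hinv_mul : ∀ x c : G, (∀ d, f (d * x) = f d * c) → ∀ d, f (d * x⁻¹) = f d * c⁻¹ := by
    intro x c hx d
    rw [eq_mul_inv_iff_mul_eq, ← hx, inv_mul_cancel_right]
  have key : ∀ x : G, ∃ c : G, ∀ d, f (d * x) = f d * c := by
    intro x
    have hx : x ∈ Subgroup.closure {r, s} := by rw [hgen]; trivial
    induction hx using Subgroup.closure_induction with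
    | mem y hy =>
      rcases hy with rfl | rfl
      · refine ⟨y * s * s, fun d => ?_⟩
        have h1 := hinv_mul s _ hs' (d * (y * s))
        rw [ht'] at h1
        simpa [mul_assoc] using h1
      · exact ⟨_, hs'⟩
    | one => exact ⟨1, by simp⟩
    | mul y z _ _ hy hz =>
      obtain ⟨c, hc⟩ := hy
      obtain ⟨c', hc'⟩ := hz
      exact ⟨c * c', fun d => by rw [← mul_assoc, hc', hc, mul_assoc]⟩
    | inv y _ hy =>
      obtain ⟨c, hc⟩ := hy
      exact ⟨c⁻¹, hinv_mul y c hc⟩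
  choose φ hφ using key
  have hφ1 : ∀ x, φ x = (f 1)⁻¹ * f x := fun x => by
    rw [eq_inv_mul_iff_mul_eq, ← hφ, one_mul]
  refine ⟨MonoidHom.mk' φ fun x y => ?_, ?_, ?_⟩
  · rw [hφ1 (x * y), hφ y x, hφ1 x, mul_assoc]
  · simpa using (hφ s 1).symm.trans (hs' 1)
  · simpa using (hφ (r * s) 1).symm.trans (ht' 1)

theorem minimalPeriod_mulRight {G : Type*} [Group G] (g d : G) :
    Function.minimalPeriod (Equiv.mulRight g) d = orderOf g := by
  rw [orderOf, Function.minimalPeriod_eq_minimalPeriod_iff]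
  intro k
  rw [isPeriodicPt_mul_iff_pow_eq_one, Function.IsPeriodicPt, Function.IsFixedPt]
  have : (⇑(Equiv.mulRight g))^[k] d = d * g ^ k := by
    rw [← Equiv.Perm.coe_pow, Equiv.pow_mulRight, Equiv.coe_mulRight]
  rw [this, mul_eq_left]

theorem OrientedMap.ofGroup_hasType {G : Type*} [Group G] (r s : G)
    (hgen : Subgroup.closure {r, s} = ⊤) (hinv : orderOf (r * s) = 2) :
    (OrientedMap.ofGroup r s hgen hinv).HasType (orderOf r) (orderOf s) := by
  refine ⟨fun d => ?_, fun d => minimalPeriod_mulRight s d⟩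
  have : (OrientedMap.ofGroup r s hgen hinv).face = Equiv.mulRight r := by
    ext x
    simp [OrientedMap.face, OrientedMap.ofGroup, mul_assoc]
  rw [this, minimalPeriod_mulRight]

/-- The commutator of `x = (s⁻¹ * t) ^ 2` with its conjugate by `s ^ 4`. -/
def shiftCommutator {G : Type*} [Group G] (s t : G) : G :=
  ⁅(s⁻¹ * t) ^ 2, s ^ 4 * (s⁻¹ * t) ^ 2 * (s ^ 4)⁻¹⁆

/-- The word in `s` and `t` that distinguishes the two orientations of the map: the commutator of
`shiftCommutator s t` with its conjugate by `t`. -/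
def chiralityWord {G : Type*} [Group G] (s t : G) : G :=
  ⁅shiftCommutator s t, t * shiftCommutator s t * t⁻¹⁆

theorem map_chiralityWord {G H : Type*} [Group G] [Group H] (f : G →* H) (s t : G) :
    f (chiralityWord s t) = chiralityWord (f s) (f t) := by
  simp [chiralityWord, shiftCommutator, map_commutatorElement]

/-! ### The words in the symmetric group -/

section Perm

open Equiv Equiv.Perm

variable {X : Type*} [DecidableEq X]

/-- Two double transpositions with exactly one common point `p` have a `3`-cycle as commutator. -/
theorem commutator_swap_mul_swap {p a b c d e f : X}
    (h : [p, a, b, c, d, e, f].Nodup) :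
    ⁅swap p a * swap b c, swap p d * swap e f⁆ = swap d a * swap d p := by
  simp only [List.nodup_cons, List.mem_cons, List.not_mem_nil, not_or, or_false] at h
  obtain ⟨⟨h1, h2, h3, h4, h5, h6⟩, ⟨g1, g2, g3, g4, g5⟩, ⟨k1, k2, k3, k4⟩, ⟨l1, l2, l3⟩,
    ⟨m1, m2⟩, n1, -⟩ := h
  have hx : (swap p a * swap b c) * (swap p d * swap e f) * (swap p a * swap b c)⁻¹ =
      swap d a * swap e f := by
    have : ∀ g : Perm X, g * (swap p d * swap e f) * g⁻¹ = swap (g p) (g d) * swap (g e) (g f) := by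
      intro g
      rw [← conj_mul, Equiv.swap_apply_apply, Equiv.swap_apply_apply]
    rw [this]
    have e1 : (swap p a * swap b c) p = a := by
      rw [mul_apply, swap_apply_of_ne_of_ne h2 h3, swap_apply_left]
    have e2 : (swap p a * swap b c) d = d := by
      rw [mul_apply, swap_apply_of_ne_of_ne (Ne.symm k2) (Ne.symm l1),
        swap_apply_of_ne_of_ne (Ne.symm h4) (Ne.symm g3)]
    have e3 : (swap p a * swap b c) e = e := by
      rw [mul_apply, swap_apply_of_ne_of_ne (Ne.symm k3) (Ne.symm l2),
        swap_apply_of_ne_of_ne (Ne.symm h5) (Ne.symm g4)]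
    have e4 : (swap p a * swap b c) f = f := by
      rw [mul_apply, swap_apply_of_ne_of_ne (Ne.symm k4) (Ne.symm l3),
        swap_apply_of_ne_of_ne (Ne.symm h6) (Ne.symm g5)]
    rw [e1, e2, e3, e4, swap_comm a d]
  rw [commutatorElement_def, hx, mul_inv_rev, swap_inv, swap_inv, mul_assoc, swap_mul_self_mul,
    swap_comm p d]

/-- The values of `s` and `t` that determine `shiftCommutator s t`: here `(s⁻¹ * t) ^ 2` is
the double transposition `(p a)(b c)`, and `s ^ 4` fixes `p` and takes `a, b, c` to three
further points, of which `d` is the first. -/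
structure ShiftData (s t : Perm X) (p a b c d e f : X) : Prop where
  sq : (s⁻¹ * t) ^ 2 = swap p a * swap b c
  fix : (s ^ 4) p = p
  map_a : (s ^ 4) a = d
  map_b : (s ^ 4) b = e
  map_c : (s ^ 4) c = f
  nodup : [p, a, b, c, d, e, f].Nodup

theorem ShiftData.shiftCommutator_eq {s t : Perm X} {p a b c d e f : X}
    (h : ShiftData s t p a b c d e f) : shiftCommutator s t = swap d a * swap d p := by
  have : s ^ 4 * (swap p a * swap b c) * (s ^ 4)⁻¹ = swap p d * swap e f := by
    rw [← conj_mul, ← Equiv.swap_apply_apply, ← Equiv.swap_apply_apply, h.fix, h.map_a, h.map_b,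
      h.map_c]
  rw [shiftCommutator, h.sq, this, commutator_swap_mul_swap h.nodup]

theorem ShiftData.isThreeCycle [Fintype X] {s t : Perm X} {p a b c d e f : X}
    (h : ShiftData s t p a b c d e f) : (shiftCommutator s t).IsThreeCycle := by
  rw [h.shiftCommutator_eq]
  have := h.nodup
  apply isThreeCycle_swap_mul_swap_same <;> rintro rfl <;> simp at this

/-- If `t` moves `p` off the `3`-cycle and keeps `a` on it, then the `3`-cycle and its
`t`-conjugate do not commute: the conjugate fixes `p` but moves its image `a`. -/
theorem ShiftData.chiralityWord_ne_one {s t : Perm X} {p a b c d e f : X}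
    (h : ShiftData s t p a b c d e f) (ht : t⁻¹ = t)
    (hp : t p ≠ p ∧ t p ≠ a ∧ t p ≠ d) (ha : t a = a ∨ t a = d) : chiralityWord s t ≠ 1 := by
  intro hw
  rw [chiralityWord, commutatorElement_eq_one_iff_mul_comm, h.shiftCommutator_eq, ht] at hw
  have hn := h.nodup
  simp only [List.nodup_cons, List.mem_cons, List.not_mem_nil, not_or, or_false] at hn
  have htt : ∀ x, t (t x) = x := fun x => by
    conv_lhs => enter [1]; rw [← ht]
    simp
  have hy : ∀ x, x ≠ p → x ≠ a → x ≠ d → (swap d a * swap d p) x = x := fun x h1 h2 h3 => by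
    rw [mul_apply, swap_apply_of_ne_of_ne h3 h1, swap_apply_of_ne_of_ne h3 h2]
  have hyp : (swap d a * swap d p) p = a := by simp
  have hya : (swap d a * swap d p) a = d := by
    rw [mul_apply, swap_apply_of_ne_of_ne (x := a) (by tauto) (by tauto), swap_apply_right]
  have hyd : (swap d a * swap d p) d = p := by
    rw [mul_apply, swap_apply_left, swap_apply_of_ne_of_ne (by tauto) (by tauto)]
  generalize swap d a * swap d p = y at *
  have h1 := congrArg (fun g : Perm X => g p) hw
  simp only [mul_apply, hyp, hy _ hp.1 hp.2.1 hp.2.2, htt] at h1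
  rcases ha with ha | ha <;> simp only [ha, hya, hyd] at h1
  · have := congrArg t h1
    rw [htt, ha] at this
    tauto
  · exact hp.2.1 h1.symm

/-- If `t` carries the three points of the `3`-cycle away from them, then the `3`-cycle and its
`t`-conjugate are disjoint. -/
theorem ShiftData.chiralityWord_eq_one {s t : Perm X} {p a b c d e f : X}
    (h : ShiftData s t p a b c d e f) (hp : t p ∉ [p, a, d]) (ha : t a ∉ [p, a, d])
    (hd : t d ∉ [p, a, d]) : chiralityWord s t = 1 := by
  have hn := h.nodup
  simp only [List.nodup_cons, List.mem_cons, List.not_mem_nil, not_or, or_false] at hn hp ha hd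
  rw [chiralityWord, commutatorElement_eq_one_iff_mul_comm, h.shiftCommutator_eq, ← conj_mul,
    ← Equiv.swap_apply_apply, ← Equiv.swap_apply_apply]
  obtain ⟨⟨hpa, -, -, hpd, -⟩, ⟨-, -, had, -⟩, -⟩ := hn
  have had' : t d ≠ t a := fun h => had (t.injective h).symm
  have hpd' : t d ≠ t p := fun h => hpd (t.injective h).symm
  have : Equiv.Perm.Disjoint (swap d a * swap d p) (swap (t d) (t a) * swap (t d) (t p)) := by
    refine Disjoint.mul_left ?_ ?_ <;> refine Disjoint.mul_right ?_ ?_ <;>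
    · apply disjoint_swap_swap
      simp only [List.nodup_cons, List.mem_cons, List.not_mem_nil, not_or, or_false]
      grind
  exact this.commute

end Perm

/-! ### The values of `s` and `t` -/

namespace Point

variable {a : ℕ} {i : PM}

theorem num_injective : Function.Injective (num : Fin (2 * a) → Point a i) :=
  fun _ _ h => by simpa [num] using h

theorem num'_injective : Function.Injective (num' : Fin (2 * a) → Point a i) :=
  fun _ _ h => by simpa [num'] using h

@[simp] theorem num_inj {j k : Fin (2 * a)} : (num j : Point a i) = num k ↔ j = k :=
  num_injective.eq_iff

@[simp] theorem num'_inj {j k : Fin (2 * a)} : (num' j : Point a i) = num' k ↔ j = k :=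
  num'_injective.eq_iff

@[simp] theorem greek_inj {x y : Greek i} : (greek x : Point a i) = greek y ↔ x = y := by
  simp [greek]

@[simp] theorem num_ne_num' (j k : Fin (2 * a)) : (num j : Point a i) ≠ num' k := by
  simp [num, num']

@[simp] theorem num'_ne_num (j k : Fin (2 * a)) : (num' j : Point a i) ≠ num k := by
  simp [num, num']

@[simp] theorem num_ne_greek (j : Fin (2 * a)) (x : Greek i) : (num j : Point a i) ≠ greek x := by
  simp [num, greek]

@[simp] theorem greek_ne_num (j : Fin (2 * a)) (x : Greek i) : (greek x : Point a i) ≠ num j := by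
  simp [num, greek]

@[simp] theorem num'_ne_greek (j : Fin (2 * a)) (x : Greek i) :
    (num' j : Point a i) ≠ greek x := by
  simp [num', greek]

@[simp] theorem greek_ne_num' (j : Fin (2 * a)) (x : Greek i) :
    (greek x : Point a i) ≠ num' j := by
  simp [num', greek]

theorem cases_on {motive : Point a i → Prop} (x : Point a i) (hnum : ∀ j, motive (num j))
    (hnum' : ∀ j, motive (num' j)) (hgreek : ∀ y, motive (greek y)) : motive x := by
  rcases x with (j | j) | y
  exacts [hnum j, hnum' j, hgreek y]

theorem nodup_cycleList (a : ℕ) (i : PM) : (cycleList a i).Nodup := by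
  cases i <;> simp [cycleList, List.nodup_append, List.nodup_map_iff num_injective,
    List.nodup_map_iff num'_injective, List.nodup_finRange]
  grind [num_ne_num', num_ne_greek, num'_ne_greek]

theorem length_cycleList (a : ℕ) (i : PM) :
    ((cycleList a i).length : ℤ) = 4 * a + 4 + i.toInt := by
  cases i <;> simp [cycleList, PM.toInt] <;> ring

theorem mem_cycleList_iff {x : Point a i} : x ∈ cycleList a i ↔ x ≠ greek .β' := by
  induction x using cases_on with
  | hnum j => cases i <;> simp [cycleList]
  | hnum' j => cases i <;> simp [cycleList]
  | hgreek y => cases i <;> cases y <;> simp [cycleList]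

theorem card_eq (a : ℕ) (i : PM) : (Fintype.card (Point a i) : ℤ) = 4 * a + 4 + i.toInt + 1 := by
  cases i
  · have : Fintype.card (Greek .minus) = 4 := rfl
    simp [this, PM.toInt]; ring
  · have : Fintype.card (Greek .plus) = 6 := rfl
    simp [this, PM.toInt]; ring

theorem getElem?_minus_num (j : ℕ) (h : j < 2 * a) :
    (cycleList a .minus)[j]? = some (num ⟨j, h⟩) := by
  simp [cycleList, List.getElem?_append, h]

theorem getElem?_plus_num (j : ℕ) (h : j < 2 * a) :
    (cycleList a .plus)[j]? = some (num ⟨j, h⟩) := by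
  simp [cycleList, List.getElem?_append, h]

theorem getElem?_minus_greek :
    (cycleList a .minus)[2 * a]? = some (greek .α) ∧
    (cycleList a .minus)[2 * a + 1]? = some (greek .α') ∧
    (cycleList a .minus)[2 * a + 2]? = some (greek .β) := by
  simp [cycleList]

theorem getElem?_plus_greek :
    (cycleList a .plus)[2 * a]? = some (greek .α) ∧
    (cycleList a .plus)[2 * a + 1]? = some (greek .β) ∧
    (cycleList a .plus)[2 * a + 2]? = some (greek .γ) ∧
    (cycleList a .plus)[2 * a + 3]? = some (greek .α') ∧
    (cycleList a .plus)[4 * a + 4]? = some (greek .δ) := by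
  have h : 4 * a + 4 = (2 * a + 4) + 2 * a := by ring
  simp [cycleList, List.getElem?_append, h]

theorem getElem?_minus_num' (j : ℕ) (h : j < 2 * a) :
    (cycleList a .minus)[4 * a + 2 - j]? = some (num' ⟨j, h⟩) := by
  have h2 : 4 * a + 2 - j - (2 * a + 3) < 2 * a := by omega
  have h3 : 2 * a - 1 - (4 * a + 2 - j - (2 * a + 3)) = j := by omega
  rw [cycleList, List.getElem?_append_right (by simp; omega), List.map_reverse,
    List.getElem?_reverse (by simpa using h2)]
  have h4 : j < (List.finRange (2 * a)).length := by simpa using h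
  simp [h3, List.getElem?_eq_getElem h4]

theorem getElem?_plus_num' (j : ℕ) (h : j < 2 * a) :
    (cycleList a .plus)[4 * a + 3 - j]? = some (num' ⟨j, h⟩) := by
  have h2 : 4 * a + 3 - j - (2 * a + 4) < 2 * a := by omega
  have h3 : 2 * a - 1 - (4 * a + 3 - j - (2 * a + 4)) = j := by omega
  rw [cycleList, List.getElem?_append_left (by simp; omega),
    List.getElem?_append_right (by simp; omega), List.map_reverse,
    List.getElem?_reverse (by simpa using h2)]
  have h4 : j < (List.finRange (2 * a)).length := by simpa using h
  simp [h3, List.getElem?_eq_getElem h4]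

end Point

open Point

theorem sPerm_pow_apply_of_getElem? {a : ℕ} {i : PM} {x y : Point a i} (u k : ℕ)
    (hx : (cycleList a i)[u]? = some x)
    (hy : (cycleList a i)[(u + k) % (cycleList a i).length]? = some y) :
    (sPerm a i ^ k) x = y := by
  obtain ⟨hu, rfl⟩ := List.getElem?_eq_some_iff.1 hx
  obtain ⟨_, rfl⟩ := List.getElem?_eq_some_iff.1 hy
  exact List.formPerm_pow_apply_getElem _ (nodup_cycleList a i) k u hu

/-- Away from the end of the list, `s ^ k` moves a point `k` places to the right. -/
theorem sPerm_pow_apply {a : ℕ} {i : PM} {x y : Point a i} (u v k : ℕ)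
    (hx : (cycleList a i)[u]? = some x) (hy : (cycleList a i)[v]? = some y) (h : u + k = v) :
    (sPerm a i ^ k) x = y := by
  subst h
  apply sPerm_pow_apply_of_getElem? u k hx
  rwa [Nat.mod_eq_of_lt (List.getElem?_eq_some_iff.1 hy).1]

theorem sPerm_apply {a : ℕ} {i : PM} {x y : Point a i} (u v : ℕ)
    (hx : (cycleList a i)[u]? = some x) (hy : (cycleList a i)[v]? = some y) (h : u + 1 = v) :
    sPerm a i x = y := by
  simpa using sPerm_pow_apply u v 1 hx hy h

theorem sPerm_apply_β' (a : ℕ) (i : PM) : sPerm a i (greek .β') = greek .β' :=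
  List.formPerm_apply_of_notMem (by simp [mem_cycleList_iff])

section tPerm

variable {a : ℕ} {i : PM}

theorem prod_map_swap_num (L : List (Fin (2 * a))) (hL : L.Nodup) :
    (∀ j, (L.map fun j => Equiv.swap (num j : Point a i) (num' j)).prod (num j) =
      if j ∈ L then num' j else num j) ∧
    (∀ j, (L.map fun j => Equiv.swap (num j : Point a i) (num' j)).prod (num' j) =
      if j ∈ L then num j else num' j) ∧
    (∀ x, (L.map fun j => Equiv.swap (num j : Point a i) (num' j)).prod (greek x) = greek x) := by
  induction L with
  | nil => simp
  | cons k L ih =>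
    obtain ⟨hk, hL⟩ := List.nodup_cons.1 hL
    obtain ⟨h1, h2, h3⟩ := ih hL
    refine ⟨fun j => ?_, fun j => ?_, fun x => ?_⟩
    · rw [List.map_cons, List.prod_cons, Equiv.Perm.mul_apply, h1]
      by_cases hj : j = k
      · simp [hj, hk]
      · by_cases hj' : j ∈ L <;> simp [hj, hj', Equiv.swap_apply_of_ne_of_ne]
    · rw [List.map_cons, List.prod_cons, Equiv.Perm.mul_apply, h2]
      by_cases hj : j = k
      · simp [hj, hk]
      · by_cases hj' : j ∈ L <;> simp [hj, hj', Equiv.swap_apply_of_ne_of_ne]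
    · rw [List.map_cons, List.prod_cons, Equiv.Perm.mul_apply, h3]
      simp [Equiv.swap_apply_of_ne_of_ne]

@[simp] theorem tPerm_num (j : Fin (2 * a)) : tPerm a i (num j) = num' j := by
  simp [tPerm, (prod_map_swap_num _ (List.nodup_finRange (2 * a))).1,
    Equiv.swap_apply_of_ne_of_ne]

@[simp] theorem tPerm_num' (j : Fin (2 * a)) : tPerm a i (num' j) = num j := by
  simp [tPerm, (prod_map_swap_num _ (List.nodup_finRange (2 * a))).2.1,
    Equiv.swap_apply_of_ne_of_ne]

theorem tPerm_greek (x : Greek i) : tPerm a i (greek x) =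
    Equiv.swap (greek .α) (greek .α') (Equiv.swap (greek .β) (greek .β') (greek x)) := by
  simp [tPerm, (prod_map_swap_num _ (List.nodup_finRange (2 * a))).2.2]

@[simp] theorem tPerm_α : tPerm a i (greek .α) = greek .α' := by
  simp [tPerm_greek, Equiv.swap_apply_of_ne_of_ne]

@[simp] theorem tPerm_α' : tPerm a i (greek .α') = greek .α := by
  simp [tPerm_greek, Equiv.swap_apply_of_ne_of_ne]

@[simp] theorem tPerm_β : tPerm a i (greek .β) = greek .β' := by
  simp [tPerm_greek, Equiv.swap_apply_of_ne_of_ne]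

@[simp] theorem tPerm_β' : tPerm a i (greek .β') = greek .β := by
  simp [tPerm_greek, Equiv.swap_apply_of_ne_of_ne]

@[simp] theorem tPerm_γ : tPerm a .plus (greek .γ) = greek .γ := by
  simp [tPerm_greek, Equiv.swap_apply_of_ne_of_ne]

@[simp] theorem tPerm_δ : tPerm a .plus (greek .δ) = greek .δ := by
  simp [tPerm_greek, Equiv.swap_apply_of_ne_of_ne]

theorem tPerm_mul_self : tPerm a i * tPerm a i = 1 := by
  ext x
  induction x using Point.cases_on with
  | hnum j => simp
  | hnum' j => simp
  | hgreek y => cases y <;> simp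

theorem tPerm_inv : (tPerm a i)⁻¹ = tPerm a i := inv_eq_of_mul_eq_one_left tPerm_mul_self

end tPerm

/-! ### The element `r` and its square -/

theorem inv_mul_sq_minus {a : ℕ} (ha : 1 ≤ a) : ((sPerm a .minus)⁻¹ * tPerm a .minus) ^ 2 =
    Equiv.swap (greek .β') (num ⟨2 * a - 1, by omega⟩) * Equiv.swap (greek .β) (greek .α') := by
  obtain ⟨hα, hα', hβ⟩ := getElem?_minus_greek (a := a)
  set r := (sPerm a .minus)⁻¹ * tPerm a .minus with hr
  have key : ∀ x y, sPerm a .minus y = tPerm a .minus x → r x = y := fun x y h => by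
    rw [hr, Equiv.Perm.mul_apply, Equiv.Perm.inv_eq_iff_eq, h]
  have r1 : ∀ j (h : j + 1 < 2 * a), r (num ⟨j, by omega⟩) = num' ⟨j + 1, h⟩ := fun j h => by
    apply key
    rw [tPerm_num]
    exact sPerm_apply _ _ (getElem?_minus_num' _ _) (getElem?_minus_num' _ _) (by omega)
  have r2 : r (num ⟨2 * a - 1, by omega⟩) = greek .β := by
    apply key
    rw [tPerm_num]
    exact sPerm_apply _ _ hβ (getElem?_minus_num' _ _) (by omega)
  have r3 : ∀ j (h : j + 1 < 2 * a), r (num' ⟨j + 1, h⟩) = num ⟨j, by omega⟩ := fun j h => by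
    apply key
    rw [tPerm_num']
    exact sPerm_apply _ _ (getElem?_minus_num _ _) (getElem?_minus_num _ _) (by omega)
  have r4 : r (num' ⟨0, by omega⟩) = num' ⟨0, by omega⟩ := by
    apply key
    rw [tPerm_num', ← pow_one (sPerm a .minus)]
    refine sPerm_pow_apply_of_getElem? _ _ (getElem?_minus_num' _ _) ?_
    have hl := length_cycleList a .minus
    rw [← getElem?_minus_num 0 (by omega), show (cycleList a .minus).length = 4 * a + 2 - 0 + 1 by
      simp only [PM.toInt] at hl; omega, Nat.mod_self]
  have r5 : r (greek .α) = greek .α := by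
    apply key
    rw [tPerm_α]
    exact sPerm_apply _ _ hα hα' rfl
  have r6 : r (greek .α') = num ⟨2 * a - 1, by omega⟩ := by
    apply key
    rw [tPerm_α']
    exact sPerm_apply _ _ (getElem?_minus_num _ _) hα (by omega)
  have r7 : r (greek .β) = greek .β' := by
    apply key
    rw [tPerm_β, sPerm_apply_β']
  have r8 : r (greek .β') = greek .α' := by
    apply key
    rw [tPerm_β']
    exact sPerm_apply _ _ hα' hβ rfl
  clear_value r
  ext x : 1
  rw [pow_two, Equiv.Perm.mul_apply, Equiv.Perm.mul_apply]
  induction x using Point.cases_on with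
  | hnum j =>
    obtain ⟨j, hj⟩ := j
    by_cases h : j + 1 < 2 * a
    · have h' : j ≠ 2 * a - 1 := by omega
      rw [r1 j h, r3 j h]; simp [Equiv.swap_apply_of_ne_of_ne, h']
    · obtain rfl : j = 2 * a - 1 := by omega
      rw [r2, r7]; simp [Equiv.swap_apply_of_ne_of_ne]
  | hnum' j =>
    obtain ⟨_ | j, hj⟩ := j
    · rw [r4, r4]; simp [Equiv.swap_apply_of_ne_of_ne]
    · rw [r3 j hj, r1 j hj]; simp [Equiv.swap_apply_of_ne_of_ne]
  | hgreek y =>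
    cases y
    · rw [r5, r5]; simp [Equiv.swap_apply_of_ne_of_ne]
    · rw [r6, r2]; simp [Equiv.swap_apply_of_ne_of_ne]
    · rw [r7, r8]; simp [Equiv.swap_apply_of_ne_of_ne]
    · rw [r8, r6]; simp [Equiv.swap_apply_of_ne_of_ne]

theorem inv_mul_sq_plus {a : ℕ} (ha : 1 ≤ a) : ((sPerm a .plus)⁻¹ * tPerm a .plus) ^ 2 =
    Equiv.swap (greek .β') (greek .γ) * Equiv.swap (greek .α) (greek .β) := by
  obtain ⟨hα, hβ, hγ, hα', hδ⟩ := getElem?_plus_greek (a := a)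
  set r := (sPerm a .plus)⁻¹ * tPerm a .plus with hr
  have key : ∀ x y, sPerm a .plus y = tPerm a .plus x → r x = y := fun x y h => by
    rw [hr, Equiv.Perm.mul_apply, Equiv.Perm.inv_eq_iff_eq, h]
  have r1 : ∀ j (h : j + 1 < 2 * a), r (num ⟨j, by omega⟩) = num' ⟨j + 1, h⟩ := fun j h => by
    apply key
    rw [tPerm_num]
    exact sPerm_apply _ _ (getElem?_plus_num' _ _) (getElem?_plus_num' _ _) (by omega)
  have r2 : r (num ⟨2 * a - 1, by omega⟩) = greek .α' := by
    apply key
    rw [tPerm_num]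
    exact sPerm_apply _ _ hα' (getElem?_plus_num' _ _) (by omega)
  have r3 : ∀ j (h : j + 1 < 2 * a), r (num' ⟨j + 1, h⟩) = num ⟨j, by omega⟩ := fun j h => by
    apply key
    rw [tPerm_num']
    exact sPerm_apply _ _ (getElem?_plus_num _ _) (getElem?_plus_num _ _) (by omega)
  have r4 : r (num' ⟨0, by omega⟩) = greek .δ := by
    apply key
    rw [tPerm_num', ← pow_one (sPerm a .plus)]
    refine sPerm_pow_apply_of_getElem? _ _ hδ ?_
    have hl := length_cycleList a .plus
    rw [← getElem?_plus_num 0 (by omega), show (cycleList a .plus).length = 4 * a + 4 + 1 by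
      simp only [PM.toInt] at hl; omega, Nat.mod_self]
  have r5 : r (greek .α) = greek .γ := by
    apply key
    rw [tPerm_α]
    exact sPerm_apply _ _ hγ hα' rfl
  have r6 : r (greek .α') = num ⟨2 * a - 1, by omega⟩ := by
    apply key
    rw [tPerm_α']
    exact sPerm_apply _ _ (getElem?_plus_num _ _) hα (by omega)
  have r7 : r (greek .β) = greek .β' := by
    apply key
    rw [tPerm_β, sPerm_apply_β']
  have r8 : r (greek .β') = greek .α := by
    apply key
    rw [tPerm_β']
    exact sPerm_apply _ _ hα hβ rfl
  have r9 : r (greek .γ) = greek .β := by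
    apply key
    rw [tPerm_γ]
    exact sPerm_apply _ _ hβ hγ rfl
  have r10 : r (greek .δ) = num' ⟨0, by omega⟩ := by
    apply key
    rw [tPerm_δ]
    exact sPerm_apply _ _ (getElem?_plus_num' _ _) hδ (by omega)
  clear_value r
  ext x : 1
  rw [pow_two, Equiv.Perm.mul_apply, Equiv.Perm.mul_apply]
  induction x using Point.cases_on with
  | hnum j =>
    obtain ⟨j, hj⟩ := j
    by_cases h : j + 1 < 2 * a
    · rw [r1 j h, r3 j h]; simp [Equiv.swap_apply_of_ne_of_ne]
    · obtain rfl : j = 2 * a - 1 := by omega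
      rw [r2, r6]; simp [Equiv.swap_apply_of_ne_of_ne]
  | hnum' j =>
    obtain ⟨_ | j, hj⟩ := j
    · rw [r4, r10]; simp [Equiv.swap_apply_of_ne_of_ne]
    · rw [r3 j hj, r1 j hj]; simp [Equiv.swap_apply_of_ne_of_ne]
  | hgreek y =>
    cases y
    · rw [r5, r9]; simp [Equiv.swap_apply_of_ne_of_ne]
    · rw [r6, r2]; simp [Equiv.swap_apply_of_ne_of_ne]
    · rw [r7, r8]; simp [Equiv.swap_apply_of_ne_of_ne]
    · rw [r8, r5]; simp [Equiv.swap_apply_of_ne_of_ne]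
    · rw [r9, r7]; simp [Equiv.swap_apply_of_ne_of_ne]
    · rw [r10, r4]; simp [Equiv.swap_apply_of_ne_of_ne]

/-! ### The distinguishing word in `s, t` and in `s⁻¹, t` -/

/-- Reversing `s` replaces `x = (s⁻¹ * t) ^ 2` by its `t`-conjugate, so it relabels the points
of a double transposition by `t`. -/
theorem mul_sq_of_inv_mul_sq {X : Type*} [DecidableEq X] {s t : Equiv.Perm X} {p a b c : X}
    (ht : t⁻¹ = t) (h : (s⁻¹ * t) ^ 2 = Equiv.swap p a * Equiv.swap b c) :
    (s⁻¹⁻¹ * t) ^ 2 = Equiv.swap (t b) (t c) * Equiv.swap (t p) (t a) := by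
  have : (s⁻¹⁻¹ * t) ^ 2 = t * ((s⁻¹ * t) ^ 2)⁻¹ * t⁻¹ := by
    simp only [pow_two, mul_inv_rev, inv_inv, mul_assoc, ht]
    rw [← mul_assoc t t (s * _), mul_eq_one_iff_eq_inv.2 ht.symm, one_mul]
  rw [this, h, mul_inv_rev, Equiv.swap_inv, Equiv.swap_inv, ← conj_mul,
    ← Equiv.swap_apply_apply, ← Equiv.swap_apply_apply]

theorem sPerm_pow_β' (a : ℕ) (i : PM) (k : ℕ) :
    (sPerm a i ^ k) (greek .β') = greek .β' :=
  Equiv.Perm.pow_apply_eq_self_of_apply_eq_self (sPerm_apply_β' a i) k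

theorem inv_pow_apply_eq {X : Type*} {s : Equiv.Perm X} {k : ℕ} {x y : X} (h : (s ^ k) y = x) :
    (s⁻¹ ^ k) x = y := by
  rw [inv_pow, Equiv.Perm.inv_eq_iff_eq, h]

theorem shiftData_minus {a : ℕ} (ha : 2 ≤ a) :
    ShiftData (sPerm a .minus) (tPerm a .minus) (greek .β') (num ⟨2 * a - 1, by omega⟩)
      (greek .β) (greek .α') (num' ⟨2 * a - 1, by omega⟩) (num' ⟨2 * a - 4, by omega⟩)
      (num' ⟨2 * a - 3, by omega⟩) where
  sq := inv_mul_sq_minus (by omega)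
  fix := sPerm_pow_β' _ _ _
  map_a := sPerm_pow_apply _ _ _ (getElem?_minus_num _ _) (getElem?_minus_num' _ _) (by omega)
  map_b := sPerm_pow_apply _ _ _ getElem?_minus_greek.2.2 (getElem?_minus_num' _ _) (by omega)
  map_c := sPerm_pow_apply _ _ _ getElem?_minus_greek.2.1 (getElem?_minus_num' _ _) (by omega)
  nodup := by simp; omega

theorem shiftData_inv_minus {a : ℕ} (ha : 2 ≤ a) :
    ShiftData (sPerm a .minus)⁻¹ (tPerm a .minus) (greek .β') (greek .α)
      (num' ⟨2 * a - 1, by omega⟩) (greek .β) (num ⟨2 * a - 4, by omega⟩)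
      (num ⟨2 * a - 1, by omega⟩) (num ⟨2 * a - 2, by omega⟩) where
  sq := by
    rw [mul_sq_of_inv_mul_sq tPerm_inv (inv_mul_sq_minus (by omega))]
    simp [Equiv.swap_comm (greek .β)]
  fix := inv_pow_apply_eq (sPerm_pow_β' _ _ _)
  map_a := inv_pow_apply_eq <|
    sPerm_pow_apply _ _ _ (getElem?_minus_num _ _) getElem?_minus_greek.1 (by omega)
  map_b := inv_pow_apply_eq <|
    sPerm_pow_apply _ _ _ (getElem?_minus_num _ _) (getElem?_minus_num' _ _) (by omega)
  map_c := inv_pow_apply_eq <|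
    sPerm_pow_apply _ _ _ (getElem?_minus_num _ _) getElem?_minus_greek.2.2 (by omega)
  nodup := by simp; omega

/-- The point four places after `γ` is `δ` if `a = 1`, and a primed number otherwise. -/
theorem exists_shiftData_plus {a : ℕ} (ha : 1 ≤ a) :
    ∃ d, ShiftData (sPerm a .plus) (tPerm a .plus) (greek .β') (greek .γ) (greek .α) (greek .β)
      d (num' ⟨2 * a - 1, by omega⟩) (num' ⟨2 * a - 2, by omega⟩) := by
  obtain ⟨hα, hβ, hγ, -, hδ⟩ := getElem?_plus_greek (a := a)
  obtain ⟨d, hd, hd'⟩ : ∃ d, (sPerm a .plus ^ 4) (greek .γ) = d ∧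
      ((d = greek .δ) ∨ ∃ h : 2 * a - 3 + 3 = 2 * a, d = num' ⟨2 * a - 3, by omega⟩) := by
    obtain rfl | h := eq_or_lt_of_le ha
    · exact ⟨greek .δ, sPerm_pow_apply _ _ _ hγ hδ rfl, .inl rfl⟩
    · exact ⟨_, sPerm_pow_apply _ _ _ hγ (getElem?_plus_num' (2 * a - 3) (by omega)) (by omega),
        .inr ⟨by omega, rfl⟩⟩
  refine ⟨d, inv_mul_sq_plus ha, sPerm_pow_β' _ _ _, hd,
    sPerm_pow_apply _ _ _ hα (getElem?_plus_num' _ _) (by omega),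
    sPerm_pow_apply _ _ _ hβ (getElem?_plus_num' _ _) (by omega), ?_⟩
  obtain rfl | ⟨h, rfl⟩ := hd' <;> simp <;> omega

/-- The point four places before `β` is `δ` if `a = 1`, and an unprimed number otherwise. -/
theorem exists_shiftData_inv_plus {a : ℕ} (ha : 1 ≤ a) :
    ∃ f, ShiftData (sPerm a .plus)⁻¹ (tPerm a .plus) (greek .β') (greek .α') (greek .γ)
      (greek .β) (num ⟨2 * a - 1, by omega⟩) (num ⟨2 * a - 2, by omega⟩) f := by
  obtain ⟨-, hβ, hγ, hα', hδ⟩ := getElem?_plus_greek (a := a)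
  obtain ⟨f, hf, hf'⟩ : ∃ f, (sPerm a .plus ^ 4) f = greek .β ∧
      ((f = greek .δ) ∨ ∃ h : 2 * a - 3 + 3 = 2 * a, f = num ⟨2 * a - 3, by omega⟩) := by
    obtain rfl | h := eq_or_lt_of_le ha
    · exact ⟨greek .δ, sPerm_pow_apply_of_getElem? _ _ hδ hβ, .inl rfl⟩
    · exact ⟨_, sPerm_pow_apply _ _ _ (getElem?_plus_num (2 * a - 3) (by omega)) hβ (by omega),
        .inr ⟨by omega, rfl⟩⟩
  refine ⟨f, ?_, inv_pow_apply_eq (sPerm_pow_β' _ _ _),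
    inv_pow_apply_eq <| sPerm_pow_apply _ _ _ (getElem?_plus_num _ _) hα' (by omega),
    inv_pow_apply_eq <| sPerm_pow_apply _ _ _ (getElem?_plus_num _ _) hγ (by omega),
    inv_pow_apply_eq hf, ?_⟩
  · rw [mul_sq_of_inv_mul_sq tPerm_inv (inv_mul_sq_plus ha)]
    simp [Equiv.swap_comm (greek .α'), Equiv.swap_comm (greek .β)]
  · obtain rfl | ⟨h, rfl⟩ := hf' <;> simp <;> omega

/-- The word tells the pair `s, t` from the pair `s⁻¹, t`. For `i = -1` the bound `9 ≤ n` gives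
`2 ≤ a`, which leaves room for the points four places before and after those of `x`. -/
theorem chiralityWord_perm {a : ℕ} {i : PM} (ha : 1 ≤ a) (h9 : 9 ≤ (4 * a + 4 + i.toInt : ℤ)) :
    chiralityWord (sPerm a i) (tPerm a i) ≠ 1 ∧
      chiralityWord (sPerm a i)⁻¹ (tPerm a i) = 1 := by
  cases i with
  | minus =>
    have ha2 : 2 ≤ a := by simp only [PM.toInt] at h9; omega
    refine ⟨(shiftData_minus ha2).chiralityWord_ne_one tPerm_inv (by simp) (by simp),
      (shiftData_inv_minus ha2).chiralityWord_eq_one ?_ ?_ ?_⟩ <;> simp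
  | plus =>
    obtain ⟨d, hd⟩ := exists_shiftData_plus ha
    obtain ⟨f, hf⟩ := exists_shiftData_inv_plus ha
    have hn := hd.nodup
    refine ⟨hd.chiralityWord_ne_one tPerm_inv ⟨by simp, by simp, ?_⟩ (by simp),
      hf.chiralityWord_eq_one ?_ ?_ ?_⟩
    · rw [tPerm_β']
      rintro rfl
      simp at hn
    all_goals simp

theorem exists_shiftData {a : ℕ} {i : PM} (ha : 1 ≤ a) (h9 : 9 ≤ (4 * a + 4 + i.toInt : ℤ)) :
    ∃ p x b c d e f, ShiftData (sPerm a i) (tPerm a i) p x b c d e f := by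
  cases i with
  | minus => exact ⟨_, _, _, _, _, _, _, shiftData_minus (by simp only [PM.toInt] at h9; omega)⟩
  | plus =>
    obtain ⟨d, hd⟩ := exists_shiftData_plus ha
    exact ⟨_, _, _, _, _, _, _, hd⟩

/-! ### Orders, signs, and the group generated by `s` and `t` -/

section Group

variable {a : ℕ} {i : PM}

theorem two_le_length_cycleList (a : ℕ) (i : PM) : 2 ≤ (cycleList a i).length := by
  have := length_cycleList a i
  cases i <;> simp only [PM.toInt] at this <;> omega

theorem isCycle_sPerm (a : ℕ) (i : PM) : (sPerm a i).IsCycle :=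
  List.isCycle_formPerm (nodup_cycleList a i) (two_le_length_cycleList a i)

theorem card_support_sPerm (a : ℕ) (i : PM) :
    (sPerm a i).support.card = (cycleList a i).length := by
  rw [sPerm, List.support_formPerm_of_nodup _ (nodup_cycleList a i) fun x hx => by
    have := two_le_length_cycleList a i
    simp [hx] at this, List.toFinset_card_of_nodup (nodup_cycleList a i)]

theorem orderOf_sPerm (a : ℕ) (i : PM) : (orderOf (sPerm a i) : ℤ) = 4 * a + 4 + i.toInt := by
  rw [(isCycle_sPerm a i).orderOf, card_support_sPerm, length_cycleList]

theorem sign_sPerm (a : ℕ) (i : PM) : Equiv.Perm.sign (sPerm a i) = 1 := by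
  have hl := length_cycleList a i
  have hodd : Odd (cycleList a i).length := by
    rw [Nat.odd_iff]
    cases i <;> simp only [PM.toInt] at hl <;> omega
  rw [(isCycle_sPerm a i).sign, card_support_sPerm, hodd.neg_one_pow, neg_neg]

theorem sign_tPerm (a : ℕ) (i : PM) : Equiv.Perm.sign (tPerm a i) = 1 := by
  rw [tPerm, Equiv.Perm.sign_mul, Equiv.Perm.sign_mul, Equiv.Perm.sign_swap (by simp),
    Equiv.Perm.sign_swap (by simp), map_list_prod, List.map_map]
  simp [Function.comp_def]

theorem tPerm_ne_one : tPerm a i ≠ 1 := fun h => by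
  have := congrArg (fun g : Equiv.Perm (Point a i) => g (greek .β)) h
  simp at this

theorem orderOf_tPerm : orderOf (tPerm a i) = 2 :=
  orderOf_eq_prime (by rw [pow_two, tPerm_mul_self]) tPerm_ne_one

theorem orderOf_inv_mul (ha : 1 ≤ a) (h9 : 9 ≤ (4 * a + 4 + i.toInt : ℤ)) :
    orderOf ((sPerm a i)⁻¹ * tPerm a i) = 4 := by
  obtain ⟨p, x, b, c, d, e, f, h⟩ := exists_shiftData ha h9
  have hn := h.nodup
  simp only [List.nodup_cons, List.mem_cons, List.not_mem_nil, not_or, or_false] at hn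
  have hdisj : Equiv.Perm.Disjoint (Equiv.swap p x) (Equiv.swap b c) :=
    Equiv.Perm.disjoint_swap_swap (by simp; tauto)
  refine orderOf_eq_prime_pow (p := 2) (n := 1) ?_ ?_
  · rw [pow_one, h.sq]
    intro h1
    have := congrArg (fun g : Equiv.Perm (Point a i) => g p) h1
    simp only [Equiv.Perm.mul_apply, Equiv.Perm.one_apply] at this
    rw [Equiv.swap_apply_of_ne_of_ne (x := p) (by tauto) (by tauto),
      Equiv.swap_apply_left] at this
    tauto
  · rw [pow_succ, pow_one, pow_mul, h.sq, hdisj.commute.mul_pow, pow_two, pow_two,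
      Equiv.swap_mul_self, Equiv.swap_mul_self, one_mul]

/-- A point other than `β'` is moved to any other such point by a power of the cycle `s`. -/
theorem exists_pow_sPerm {x y : Point a i} (hx : x ≠ greek .β') (hy : y ≠ greek .β') :
    ∃ k : ℤ, (sPerm a i ^ k) x = y := by
  have h : ∀ z : Point a i, z ≠ greek .β' → sPerm a i z ≠ z := fun z hz => by
    rw [← Equiv.Perm.mem_support, sPerm,
      List.support_formPerm_of_nodup _ (nodup_cycleList a i) fun w hw => by
        have := two_le_length_cycleList a i
        simp [hw] at this]
    simpa [mem_cycleList_iff] using hz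
  exact (isCycle_sPerm a i).exists_zpow_eq (h x hx) (h y hy)

/-- The subgroup generated by `s` and `t` in `Equiv.Perm` is `2`-transitive: `t` moves `β'`, and
its stabilizer contains the cycle `s` on all other points. -/
theorem isMultiplyPretransitive_closure (a : ℕ) (i : PM) :
    MulAction.IsMultiplyPretransitive (Subgroup.closure {sPerm a i, tPerm a i}) (Point a i) 2 := by
  set H := Subgroup.closure {sPerm a i, tPerm a i}
  have hs : sPerm a i ∈ H := Subgroup.subset_closure (by simp)
  have ht : tPerm a i ∈ H := Subgroup.subset_closure (by simp)
  have h1 : ∀ x : Point a i, ∃ g ∈ H, g x = greek .β' := by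
    intro x
    by_cases hx : x = greek .β'
    · exact ⟨1, one_mem _, hx⟩
    · obtain ⟨k, hk⟩ := exists_pow_sPerm hx (y := greek .β) (by simp)
      exact ⟨tPerm a i * sPerm a i ^ k, mul_mem ht (zpow_mem hs k), by simp [hk]⟩
  have h2 : ∀ x y : Point a i, x ≠ y → ∃ g ∈ H, g x = greek .β' ∧ g y = greek .β := by
    intro x y hxy
    obtain ⟨g, hg, hgx⟩ := h1 x
    obtain ⟨k, hk⟩ := exists_pow_sPerm (x := g y) (y := greek .β)
      (by rw [← hgx]; exact fun h => hxy (g.injective h).symm) (by simp)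
    refine ⟨sPerm a i ^ k * g, mul_mem (zpow_mem hs k) hg, ?_, by simpa using hk⟩
    rw [Equiv.Perm.mul_apply, hgx]
    exact Equiv.Perm.zpow_apply_eq_self_of_apply_eq_self (sPerm_apply_β' a i) k
  rw [MulAction.is_two_pretransitive_iff]
  intro x y z w hxy hzw
  obtain ⟨g, hg, hgx, hgy⟩ := h2 x y hxy
  obtain ⟨g', hg', hgz, hgw⟩ := h2 z w hzw
  refine ⟨⟨g'⁻¹ * g, mul_mem (inv_mem hg') hg⟩, ?_, ?_⟩
  · change (g'⁻¹ * g) x = z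
    rw [Equiv.Perm.mul_apply, Equiv.Perm.inv_eq_iff_eq, hgx, hgz]
  · change (g'⁻¹ * g) y = w
    rw [Equiv.Perm.mul_apply, Equiv.Perm.inv_eq_iff_eq, hgy, hgw]

theorem closure_eq_alternatingGroup (ha : 1 ≤ a) (h9 : 9 ≤ (4 * a + 4 + i.toInt : ℤ)) :
    Subgroup.closure {sPerm a i, tPerm a i} = alternatingGroup (Point a i) := by
  apply le_antisymm
  · rw [Subgroup.closure_le]
    rintro g (rfl | rfl)
    exacts [sign_sPerm a i, sign_tPerm a i]
  · obtain ⟨p, x, b, c, d, e, f, h⟩ := exists_shiftData ha h9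
    refine Equiv.Perm.alternatingGroup_le_of_isPreprimitive_of_isThreeCycle_mem
      (MulAction.isPreprimitive_of_is_two_pretransitive (isMultiplyPretransitive_closure a i))
      h.isThreeCycle ?_
    have hs : sPerm a i ∈ Subgroup.closure {sPerm a i, tPerm a i} :=
      Subgroup.subset_closure (by simp)
    have ht : tPerm a i ∈ Subgroup.closure {sPerm a i, tPerm a i} :=
      Subgroup.subset_closure (by simp)
    have hx := pow_mem (mul_mem (inv_mem hs) ht) 2
    have hy := mul_mem (mul_mem (pow_mem hs 4) hx) (inv_mem (pow_mem hs 4))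
    exact mul_mem (mul_mem (mul_mem hx hy) (inv_mem hx)) (inv_mem hy)

theorem mapGroup_eq_op (a : ℕ) (i : PM) :
    mapGroup a i = (Subgroup.closure {sPerm a i, tPerm a i}).op := by
  rw [mapGroup, Subgroup.op_closure]
  congr 1
  ext g
  simp [← MulOpposite.unop_inj]

/-- The embedding of `G` into `Equiv.Perm`, where products are read from right to left; inversion
makes it multiplicative, so it sends `s` to `s⁻¹`. -/
def mapGroupHom (a : ℕ) (i : PM) : mapGroup a i →* Equiv.Perm (Point a i) :=
  (MulEquiv.inv' (Equiv.Perm (Point a i))).symm.toMonoidHom.comp (mapGroup a i).subtype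

theorem mapGroupHom_injective (a : ℕ) (i : PM) : Function.Injective (mapGroupHom a i) :=
  (MulEquiv.inv' (Equiv.Perm (Point a i))).symm.injective.comp Subtype.val_injective

theorem mapGroupHom_sGen (a : ℕ) (i : PM) : mapGroupHom a i (sGen a i) = (sPerm a i)⁻¹ := rfl

theorem mapGroupHom_tGen (a : ℕ) (i : PM) : mapGroupHom a i (tGen a i) = tPerm a i :=
  tPerm_inv

theorem closure_rGen_sGen (a : ℕ) (i : PM) : Subgroup.closure {rGen a i, sGen a i} = ⊤ := by
  rw [eq_top_iff]
  have h : (⊤ : Subgroup (mapGroup a i)) = Subgroup.closure {sGen a i, tGen a i} := by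
    apply Subgroup.map_injective (mapGroup a i).subtype_injective
    rw [MonoidHom.map_closure, Set.image_pair, ← MonoidHom.range_eq_map, Subgroup.range_subtype]
    rfl
  rw [h, Subgroup.closure_le]
  have hs : sGen a i ∈ Subgroup.closure {rGen a i, sGen a i} := Subgroup.subset_closure (by simp)
  have hr : rGen a i ∈ Subgroup.closure {rGen a i, sGen a i} := Subgroup.subset_closure (by simp)
  rintro g (rfl | rfl)
  · exact hs
  · simpa [rGen] using mul_mem hr hs

theorem rGen_mul_sGen (a : ℕ) (i : PM) : rGen a i * sGen a i = tGen a i := by simp [rGen]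

theorem orderOf_rGen_mul_sGen (a : ℕ) (i : PM) : orderOf (rGen a i * sGen a i) = 2 := by
  rw [rGen_mul_sGen, ← orderOf_injective _ (mapGroupHom_injective a i), mapGroupHom_tGen,
    orderOf_tPerm]

theorem orderOf_sGen (a : ℕ) (i : PM) : (orderOf (sGen a i) : ℤ) = 4 * a + 4 + i.toInt := by
  rw [← orderOf_injective _ (mapGroupHom_injective a i), mapGroupHom_sGen, orderOf_inv,
    orderOf_sPerm]

theorem orderOf_rGen (ha : 1 ≤ a) (h9 : 9 ≤ (4 * a + 4 + i.toInt : ℤ)) :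
    orderOf (rGen a i) = 4 := by
  have : mapGroupHom a i (rGen a i) = ((sPerm a i)⁻¹ * tPerm a i)⁻¹ := by
    rw [rGen, map_mul, map_inv, mapGroupHom_tGen, mapGroupHom_sGen, mul_inv_rev, tPerm_inv]
  rw [← orderOf_injective _ (mapGroupHom_injective a i), this, orderOf_inv, orderOf_inv_mul ha h9]

/-- A reflection would induce an endomorphism of `G` taking `chiralityWord s t` to
`chiralityWord s⁻¹ t`; but just one of these two words is trivial. -/
theorem not_hasReflection (ha : 1 ≤ a) (h9 : 9 ≤ (4 * a + 4 + i.toInt : ℤ)) :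
    ¬ (OrientedMap.ofGroup (rGen a i) (sGen a i) (closure_rGen_sGen a i)
      (orderOf_rGen_mul_sGen a i)).HasReflection := by
  intro hrefl
  obtain ⟨φ, hs, ht⟩ := OrientedMap.exists_hom_of_hasReflection _ _ _ _ hrefl
  rw [rGen_mul_sGen] at ht
  obtain ⟨hne, heq⟩ := chiralityWord_perm ha h9
  have h1 : chiralityWord (sGen a i) (tGen a i) = 1 := by
    apply mapGroupHom_injective a i
    rw [map_chiralityWord, mapGroupHom_sGen, mapGroupHom_tGen, heq, map_one]
  apply hne
  have h2 := congrArg (mapGroupHom a i) (congrArg φ h1)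
  rwa [map_chiralityWord, hs, ht, map_chiralityWord, map_inv, mapGroupHom_sGen, inv_inv,
    mapGroupHom_tGen, map_one, map_one] at h2

end Group

theorem proposition3p1 (a n : ℕ) (i : PM) (ha : 1 ≤ a) (hn : (n : ℤ) = 4 * a + 4 + i.toInt)
    (hn9 : 9 ≤ n) :
    (∃ (hgen : Subgroup.closure {rGen a i, sGen a i} = ⊤)
        (hinv : orderOf (rGen a i * sGen a i) = 2),
      (OrientedMap.ofGroup (rGen a i) (sGen a i) hgen hinv).IsChiral ∧
      (OrientedMap.ofGroup (rGen a i) (sGen a i) hgen hinv).HasType 4 n) ∧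
    Fintype.card (Point a i) = n + 1 ∧
    mapGroup a i = (alternatingGroup (Point a i)).op := by
  have h9 : 9 ≤ (4 * a + 4 + i.toInt : ℤ) := by omega
  refine ⟨⟨closure_rGen_sGen a i, orderOf_rGen_mul_sGen a i,
    ⟨OrientedMap.ofGroup_isOrientablyRegular _ _ _ _, fun h => not_hasReflection ha h9 h.2⟩, ?_⟩,
    ?_, ?_⟩
  · have hs : orderOf (sGen a i) = n := by
      have := orderOf_sGen a i
      omega
    have := OrientedMap.ofGroup_hasType (rGen a i) (sGen a i) (closure_rGen_sGen a i)
      (orderOf_rGen_mul_sGen a i)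
    rwa [orderOf_rGen ha h9, hs] at this
  · have := card_eq a i
    omega
  · rw [mapGroup_eq_op, closure_eq_alternatingGroup ha h9]
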